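/- Let $(W,S)$ be a finite Coxeter group with simple reflections $S=(s_i)_{i\in I}$, $I$ finite, length function $\ell$ and identity $1$. Write $u\le_R w$ (right weak order; resp. $u\le_L w$, left weak order) if some reduced word for $u$ is a prefix (resp. suffix) of some reduced word for $w$, and $[1,w]_R=\{u: u\le_R w\}$. For $J\subseteq I$ let $W_J=\langle s_j: j\in J\rangle$. Every $w\in W$ factors uniquely as $w=w^K x$ with $x\in W_K$ and $\ell(w^Ks_k)>\ell(w^K)$ for all $k\in K$, and uniquely as $w=y\,{}^Jw$ with $y\in W_J$ and $\ell(s_j\,{}^Jw)>\ell({}^Jw)$ for all $j\in J$. A set $K\subseteq I$ is a right block of $w$ (resp. $J\subseteq I$ is a left block of $w$) if there is $J\subseteq I$ (resp. $K\subseteq I$) with $wW_K=W_Jw$. A right block $K$ is nontrivial if $w^K\ne w$, and a left block $J$ is nontrivial if ${}^Jw\neq w$. Write $v\sqsubseteq w$ if $v=w^K$ for some right block $K$ of $w$. Then the following hold. 1. The relation $\sqsubseteq$ is a partial order on $W$ with minimum $1$, and $u\sqsubseteq w$ implies $u\le_R w$ and $u\le_L w$. 2. Every interval $[u,w]_\sqsubseteq$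 is a sublattice of both weak orders: for $x,y\in[u,w]_\sqsubseteq$ we have $x\sqsubseteq y\iff x\le_R y\iff x\le_L y$, and there are $m,j\in[u,w]_\sqsubseteq$ such that $m$ is the meet and $j$ is the join of $x,y$ in $(W,\le_R)$ as well as in $(W,\le_L)$. 3. For every $w\in W$, the map $K\mapsto w^K$ (resp. $J\mapsto{}^Jw$) is a bijection from the set of inclusion-minimal nontrivial right (resp. left) blocks of $w$ onto the set $C_w$ of $\sqsubseteq$-lower covers of $w$. 4. For $w\in W$, let $L_w$ be the meet-semilattice generated by $C_w$ in $(W,\sqsubseteq)$, with $w$ as the empty meet. It is free on $C_w$: for each $A\subseteq C_w$ the meet $\bigwedge A$ (the greatest lower bound of $A\cup\{w\}$ for $\sqsubseteq$) exists in $(W,\sqsubseteq)$, and $A\mapsto\bigwedge A$ is an isomorphism from the set of subsets of $C_w$, ordered by reverse inclusion, onto $(L_w,\sqsubseteq)$. Moreover, $U\mapsto w^U$ (resp. $U\mapsto{}^Uw$) is an isomorphism from the lattice of unions of minimal nontrivial right (resp. left) blocks of $w$ (including the empty union), ordered by reverse inclusion, onto $(L_w,\sqsubseteq)$. Likewise $u\mapsto[1,u]_R$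 is an isomorphism from $(L_w,\sqsubseteq)$ onto the set of all intersections $[1,w]_R\cap\bigcap_{u\in A}[1,u]_R$, $A\subseteq C_w$, ordered by inclusion, and $[1,\bigwedge A]_R=[1,w]_R\cap\bigcap_{u\in A}[1,u]_R$. 5. The Möbius function of $(W,\sqsubseteq)$ satisfies $\mu(\bigwedge A,w)=(-1)^{|A|}$ for every $A\subseteq C_w$, and $\mu(u,w)=0$ for $u\notin L_w$. -/

import Mathlib

open scoped Pointwise

namespace CoxeterSystem

variable {B W : Type*} [Group W] {M : CoxeterMatrix B} (cs : CoxeterSystem M W)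

/-- Right weak order: some reduced word for `u` is a left factor (a prefix) of some reduced word
for `w`. -/
def RightWeakLE (u w : W) : Prop :=
  ∃ μ ν : List B, cs.IsReduced μ ∧ cs.IsReduced ν ∧
    cs.wordProd μ = u ∧ cs.wordProd ν = w ∧ μ <+: ν

/-- Left weak order: some reduced word for `u` is a right factor (a suffix) of some reduced word
for `w`. -/
def LeftWeakLE (u w : W) : Prop :=
  ∃ μ ν : List B, cs.IsReduced μ ∧ cs.IsReduced ν ∧
    cs.wordProd μ = u ∧ cs.wordProd ν = w ∧ μ <:+ ν

/-- The interval `[1, w]_R` in right weak order. -/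
def rightWeakInterval (w : W) : Set W := {u | cs.RightWeakLE u w}

/-- The standard parabolic subgroup `W_J`. -/
def parabolic (J : Set B) : Subgroup W := Subgroup.closure (cs.simple '' J)

theorem exists_rightRep (K : Set B) (w : W) :
    ∃ v : W, v⁻¹ * w ∈ cs.parabolic K ∧ ∀ k ∈ K, ¬ cs.IsRightDescent v k := by
  induction h : cs.length w using Nat.strong_induction_on generalizing w with
  | _ n ih =>
    by_cases hw : ∃ k ∈ K, cs.IsRightDescent w k
    · obtain ⟨k, hk, hd⟩ := hw
      obtain ⟨v, hv, hv'⟩ := ih _ (h ▸ hd) (w * cs.simple k) rfl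
      refine ⟨v, ?_, hv'⟩
      have hs : cs.simple k ∈ cs.parabolic K := Subgroup.subset_closure ⟨k, hk, rfl⟩
      have := Subgroup.mul_mem _ hv hs
      simpa [mul_assoc] using this
    · push Not at hw
      exact ⟨w, by simp, hw⟩

theorem exists_leftRep (J : Set B) (w : W) :
    ∃ v : W, w * v⁻¹ ∈ cs.parabolic J ∧ ∀ j ∈ J, ¬ cs.IsLeftDescent v j := by
  obtain ⟨v, hv, hv'⟩ := cs.exists_rightRep J w⁻¹
  refine ⟨v⁻¹, ?_, fun j hj => ?_⟩
  · simpa using Subgroup.inv_mem _ hv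
  · simpa [cs.isLeftDescent_inv_iff] using hv' j hj

/-- `w^K`: the factor with no right descent in `K` in the (unique) decomposition
`w = w^K * x` with `x ∈ W_K`. -/
noncomputable def rightRep (K : Set B) (w : W) : W := (cs.exists_rightRep K w).choose

/-- `^J w`: the factor with no left descent in `J` in the (unique) decomposition
`w = x * ^J w` with `x ∈ W_J`. -/
noncomputable def leftRep (J : Set B) (w : W) : W := (cs.exists_leftRep J w).choose

/-- `K` is a right block of `w`: there is `J` with `w W_K = W_J w`. -/
def IsRightBlock (w : W) (K : Set B) : Prop :=
  ∃ J : Set B, ({w} : Set W) * (cs.parabolic K : Set W) = (cs.parabolic J : Set W) * {w}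

/-- `J` is a left block of `w`: there is `K` with `w W_K = W_J w`. -/
def IsLeftBlock (w : W) (J : Set B) : Prop :=
  ∃ K : Set B, ({w} : Set W) * (cs.parabolic K : Set W) = (cs.parabolic J : Set W) * {w}

/-- The cutting relation `v ⊑ w`: `v` is a cutting point `w^K` for some right block `K` of `w`. -/
def CutLE (v w : W) : Prop := ∃ K : Set B, cs.IsRightBlock w K ∧ v = cs.rightRep K w

/-- The nontrivial right blocks of `w` which are minimal for inclusion. -/
def minimalRightBlocks (w : W) : Set (Set B) :=
  {K | Minimal (fun K => cs.IsRightBlock w K ∧ cs.rightRep K w ≠ w) K}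

/-- The nontrivial left blocks of `w` which are minimal for inclusion. -/
def minimalLeftBlocks (w : W) : Set (Set B) :=
  {J | Minimal (fun J => cs.IsLeftBlock w J ∧ cs.leftRep J w ≠ w) J}

end CoxeterSystem

/-- All unions of subfamilies of `F` (the empty union is `∅`). -/
def unionsOf {α : Type*} (F : Set (Set α)) : Set (Set α) := {U | ∃ G ⊆ F, U = ⋃₀ G}

/-- `m` is the greatest lower bound of `a` and `b` for the relation `r`. -/
def IsMeetFor {α : Type*} (r : α → α → Prop) (a b m : α) : Prop := @IsGLB α ⟨r⟩ {a, b} m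

/-- `j` is the least upper bound of `a` and `b` for the relation `r`. -/
def IsJoinFor {α : Type*} (r : α → α → Prop) (a b j : α) : Prop := @IsLUB α ⟨r⟩ {a, b} j

/-- Membership in the meet-semilattice generated by the lower covers of `w`
(with `w` as the empty meet). -/
inductive MemCoverMeets {α : Type*} [PartialOrder α] (w : α) : α → Prop
  | top : MemCoverMeets w w
  | cover {u : α} : u ⋖ w → MemCoverMeets w u
  | meet {a b m : α} : MemCoverMeets w a → MemCoverMeets w b → IsGLB {a, b} m → MemCoverMeets w m

/-- The meet-semilattice generated by the lower covers of `w`. -/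
def coverMeets {α : Type*} [PartialOrder α] (w : α) : Set α := {u | MemCoverMeets w u}

open scoped Classical in
/-- The Möbius function of a finite poset. -/
noncomputable def moebiusFn {α : Type*} [Finite α] [PartialOrder α] (a b : α) : ℤ :=
  letI : Fintype α := Fintype.ofFinite α
  letI : LocallyFiniteOrder α := Fintype.toLocallyFiniteOrder
  IncidenceAlgebra.mu ℤ a b

/-! Everything is read off inversion sets. Write N(w) for `invSet w`. It obeys N(xy) = N(x) △ x N(y)
x⁻¹, and u ≤_R w holds exactly when N(u) ⊆ N(w) (`rightWeakLE_iff_invSet`). If w W_K w⁻¹ = W_J, then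
w^K = ^J w and N(w^K) = N(w) \ W_J (`IsBlockPair.invSet_rightRep`). Blocks of a fixed w are closed
under unions and intersections, and w^{K ∪ K'}, w^{K ∩ K'} are the meet and the join of w^K, w^{K'}
in right weak order; inversion of group elements transfers this to left weak order.

Being a block with respect to K depends only on the coset w W_K, so the cutting points of w^K come
from the blocks of w that contain K (`CutLE.exists_superset`). This yields transitivity and the
sublattice property of intervals.

Two distinct minimal nontrivial blocks intersect in a trivial block, that is, one without right
descents of w. Hence a lower cover lying above a meet of lower covers is one of them
(`isFreeMeet_coverMeet`). This is freeness, and the Möbius values then reduce to the alternating sum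
over the subsets of a finite set. -/

namespace CoxeterSystem

/-! ### The geometric representation; a standard parabolic subgroup determines its simple
reflections. -/

section GeometricRepresentation

open Module Polynomial.Chebyshev

/-- The product of two reflections is a rotation of order dividing `m` if the product of the
off-diagonal Cartan entries is `4 cos² (π / m)`. -/
theorem reflection_mul_reflection_pow_eq_one {V : Type*} [AddCommGroup V] [Module ℝ V]
    {x y : V} {f g : Dual ℝ V} (hf : f x = 2) (hg : g y = 2) {m : ℕ} (hm : 3 ≤ m)
    (h : f y * g x = 4 * Real.cos (Real.pi / m) ^ 2) :
    (reflection hf * reflection hg) ^ m = 1 := by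
  have hm0 : (0 : ℝ) < m := by positivity
  have hm3 : (3 : ℝ) ≤ m := by exact_mod_cast hm
  set θ : ℝ := 2 * Real.pi / m with hθ
  have hmθ : m * θ = 2 * Real.pi := by rw [hθ]; field_simp
  have hsin : Real.sin θ ≠ 0 := by
    have hpos : 0 < θ := by positivity
    have hlt : θ < Real.pi := by
      rw [hθ, div_lt_iff₀ hm0]; nlinarith [Real.pi_pos]
    exact (Real.sin_pos_of_pos_of_lt_pi hpos hlt).ne'
  have ht : f y * g x - 2 = 2 * Real.cos θ := by
    rw [h, hθ, mul_div_assoc, Real.cos_two_mul]; ring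
  have hS (n : ℤ) : (S ℝ n).eval (2 * Real.cos θ) = Real.sin ((n + 1) * θ) / Real.sin θ := by
    rw [eq_div_iff hsin, S_two_mul_real_cos]
  ext z
  rw [reflection_mul_reflection_pow_apply hf hg m z (2 * Real.cos θ) ht.symm]
  -- These are the coefficients in the closed formula for the m-th power. For m = 2k, S_{k-1}
  -- vanishes as sin kθ = sin π = 0; for m = 2k + 1, S_k + S_{k-1} vanishes as (k + 1)θ = 2π - kθ.
  have key : (S ℝ (((m : ℤ) - 2) / 2)).eval (2 * Real.cos θ) *
      ((S ℝ (((m : ℤ) - 1) / 2)).eval (2 * Real.cos θ) +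
        (S ℝ (((m : ℤ) - 3) / 2)).eval (2 * Real.cos θ)) = 0 ∧
      (S ℝ (((m : ℤ) - 1) / 2)).eval (2 * Real.cos θ) *
      ((S ℝ ((m : ℤ) / 2)).eval (2 * Real.cos θ) +
        (S ℝ (((m : ℤ) - 2) / 2)).eval (2 * Real.cos θ)) = 0 := by
    obtain ⟨k, hk⟩ := Nat.even_or_odd' m
    rcases hk with hk | hk
    · have h1 : ((m : ℤ) - 2) / 2 = k - 1 := by lia
      have h2 : ((m : ℤ) - 1) / 2 = k - 1 := by lia
      have h0 : (S ℝ ((k : ℤ) - 1)).eval (2 * Real.cos θ) = 0 := by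
        rw [hS]
        have : (((k : ℤ) - 1 : ℤ) + 1 : ℝ) * θ = Real.pi := by
          push_cast
          rw [hk] at hmθ
          push_cast at hmθ
          linarith
        rw [this]; simp
      rw [h1, h2, h0]; simp
    · have h1 : ((m : ℤ) - 2) / 2 = k - 1 := by lia
      have h2 : ((m : ℤ) - 1) / 2 = k := by lia
      have h3 : ((m : ℤ) - 3) / 2 = k - 1 := by lia
      have h4 : (m : ℤ) / 2 = k := by lia
      have h0 : (S ℝ (k : ℤ)).eval (2 * Real.cos θ) +
          (S ℝ ((k : ℤ) - 1)).eval (2 * Real.cos θ) = 0 := by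
        rw [hS, hS, ← add_div]
        have : ((k : ℤ) + 1 : ℝ) * θ = 2 * Real.pi - (((k : ℤ) - 1 : ℤ) + 1 : ℝ) * θ := by
          push_cast
          rw [hk] at hmθ
          push_cast at hmθ
          linarith
        rw [this, Real.sin_two_pi_sub]; simp
      rw [h1, h2, h3, h4, h0]; simp
  simp [key.1, key.2]

variable {B W : Type*} [Group W] {M : CoxeterMatrix B} (cs : CoxeterSystem M W)

variable (M) in
/-- The coroot of the geometric representation attached to `i`. -/
noncomputable def coroot (i : B) : Dual ℝ (B →₀ ℝ) :=
  Finsupp.linearCombination ℝ fun j => -2 * Real.cos (Real.pi / M i j)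

theorem coroot_single (i j : B) :
    coroot M i (Finsupp.single j 1) = -2 * Real.cos (Real.pi / M i j) := by
  simp [coroot, Finsupp.linearCombination_single]

theorem coroot_single_self (i : B) : coroot M i (Finsupp.single i 1) = 2 := by
  simp [coroot_single]

/-- An entry 0 of the Coxeter matrix imposes no relation, entry 2 makes the reflections commute, and
the other off-diagonal entries give rotations. -/
theorem isLiftable_reflection :
    M.IsLiftable fun i => reflection (coroot_single_self (M := M) i) := by
  intro i j
  by_cases hij : i = j
  · subst hij
    ext z : 1
    simp [LinearEquiv.mul_apply, involutive_reflection _ _]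
  have h1 : M i j ≠ 1 := M.off_diagonal i j hij
  have hs : M j i = M i j := M.symmetric j i
  obtain h | h | h : M i j = 0 ∨ M i j = 2 ∨ 3 ≤ M i j := by omega
  · simp [h]
  · have hx : coroot M i (Finsupp.single j 1) = 0 := by simp [coroot_single, h]
    have hy : coroot M j (Finsupp.single i 1) = 0 := by simp [coroot_single, h, hs]
    rw [h]
    ext z : 1
    simp only [pow_two, LinearEquiv.mul_apply, reflection_apply, map_sub, map_smul, hx, hy,
      coroot_single_self, LinearEquiv.coe_one, id]
    module
  · refine reflection_mul_reflection_pow_eq_one _ _ h ?_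
    rw [coroot_single, coroot_single, hs]; ring

/-- The geometric representation of a Coxeter group. -/
noncomputable def geometricRep : W →* ((B →₀ ℝ) ≃ₗ[ℝ] (B →₀ ℝ)) :=
  cs.lift ⟨_, isLiftable_reflection⟩

theorem geometricRep_simple (i : B) :
    cs.geometricRep (cs.simple i) = reflection (coroot_single_self (M := M) i) :=
  cs.lift_apply_simple isLiftable_reflection i

/-- The reflection in `j` changes a vector only by a multiple of the basis vector e_j. -/
theorem geometricRep_apply_eq_of_mem_parabolic {J : Set B} {i : B} (hi : i ∉ J) {y : W}
    (hy : y ∈ cs.parabolic J) (z : B →₀ ℝ) : cs.geometricRep y z i = z i := by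
  induction hy using Subgroup.closure_induction generalizing z with
  | mem x hx =>
    obtain ⟨j, hj, rfl⟩ := hx
    have hne : j ≠ i := fun h => hi (h ▸ hj)
    simp [geometricRep_simple, reflection_apply, hne]
  | one => simp
  | mul x y _ _ hx hy => rw [map_mul, LinearEquiv.mul_apply, hx, hy]
  | inv x _ hx =>
    have h : cs.geometricRep x (cs.geometricRep x⁻¹ z) = z := by
      rw [← LinearEquiv.mul_apply, ← map_mul]; simp
    rw [← hx, h]

/-- If i ∉ J, then W_J preserves the i-th coordinate, whereas s_i negates that of e_i. -/
theorem simple_mem_parabolic_iff {J : Set B} {i : B} :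
    cs.simple i ∈ cs.parabolic J ↔ i ∈ J := by
  refine ⟨fun h => ?_, fun h => Subgroup.subset_closure ⟨i, h, rfl⟩⟩
  by_contra hi
  have := cs.geometricRep_apply_eq_of_mem_parabolic hi h (Finsupp.single i 1)
  rw [geometricRep_simple, reflection_apply_self] at this
  norm_num at this

end GeometricRepresentation

/-! ### Inversion sets and right weak order. -/

section Inversions

theorem endMul_apply {α : Type*} (f g : Function.End α) (a : α) : (f * g) a = f (g a) := rfl

variable {B W : Type*} [Group W] {M : CoxeterMatrix B} (cs : CoxeterSystem M W)

open scoped Classical in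
/-- The action of a simple reflection on `W × ZMod 2` recording inversions. -/
noncomputable def signedConj (i : B) : Function.End (W × ZMod 2) := fun p =>
  (cs.simple i * p.1 * cs.simple i, p.2 + if p.1 = cs.simple i then 1 else 0)

open scoped Classical in
-- The sign flips exactly when the first coordinate meets one of the 2n elements s_j (s_i s_j)^k, k
-- < 2n.
theorem signedConj_mul_pow (i j : B) (n : ℕ) (p : W × ZMod 2) :
    ((cs.signedConj i * cs.signedConj j) ^ n) p =
      ((cs.simple i * cs.simple j) ^ n * p.1 * ((cs.simple i * cs.simple j) ^ n)⁻¹,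
        p.2 + ∑ k ∈ Finset.range (2 * n),
          if p.1 = cs.simple j * (cs.simple i * cs.simple j) ^ k then 1 else 0) := by
  induction n with
  | zero => simp; rfl
  | succ n ih =>
    have hc : ∀ k : ℕ, ((cs.simple i * cs.simple j) ^ k)⁻¹ * cs.simple j =
        cs.simple j * (cs.simple i * cs.simple j) ^ k := by
      intro k
      induction k with
      | zero => simp
      | succ k ih =>
        rw [pow_succ, mul_inv_rev, mul_assoc, ih, mul_inv_rev, cs.inv_simple, cs.inv_simple,
          ← pow_succ, pow_succ']
        simp [mul_assoc]
    set c := cs.simple i * cs.simple j with hcdef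
    rw [pow_succ', endMul_apply, ih, endMul_apply]
    have e1 : c ^ n * p.1 * (c ^ n)⁻¹ = cs.simple j ↔ p.1 = cs.simple j * c ^ (2 * n) := by
      rw [mul_inv_eq_iff_eq_mul, ← eq_inv_mul_iff_mul_eq, ← mul_assoc, hc, mul_assoc, ← pow_add,
        two_mul]
    have e2 : cs.simple j * (c ^ n * p.1 * (c ^ n)⁻¹) * cs.simple j = cs.simple i ↔
        p.1 = cs.simple j * c ^ (2 * n + 1) := by
      have : cs.simple j * (c ^ n * p.1 * (c ^ n)⁻¹) * cs.simple j = cs.simple i ↔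
            c ^ n * p.1 * (c ^ n)⁻¹ = cs.simple j * c := by
        generalize c ^ n * p.1 * (c ^ n)⁻¹ = x
        constructor
        · intro h
          rw [hcdef, ← h]; simp [mul_assoc]
        · intro h
          rw [h, hcdef]; simp [mul_assoc]
      rw [this, mul_inv_eq_iff_eq_mul, ← eq_inv_mul_iff_mul_eq, mul_assoc, ← mul_assoc, hc,
        mul_assoc, ← pow_succ', ← pow_add]
      ring_nf
    simp only [signedConj, e1, e2]
    rw [show 2 * (n + 1) = 2 * n + 1 + 1 by ring, Finset.sum_range_succ, Finset.sum_range_succ]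
    ext
    · simp [pow_succ', hcdef, mul_assoc]
    · simp [add_assoc]

/-- For n = `M i j` the list of 2n elements is one list of n elements repeated twice, so the total
sign change is even. -/
theorem isLiftable_signedConj : M.IsLiftable cs.signedConj := by
  classical
  intro i j
  funext p
  rw [signedConj_mul_pow, cs.simple_mul_simple_pow, two_mul, Finset.sum_range_add]
  simp only [pow_add, cs.simple_mul_simple_pow, one_mul, ← two_mul]
  have : (2 : ZMod 2) = 0 := rfl
  simp only [this, zero_mul, add_zero, inv_one, mul_one]
  rfl

/-- The action of the Coxeter group on `W × ZMod 2` recording inversions. -/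
noncomputable def signedConjHom : W →* Function.End (W × ZMod 2) :=
  cs.lift ⟨_, cs.isLiftable_signedConj⟩

theorem signedConjHom_simple (i : B) : cs.signedConjHom (cs.simple i) = cs.signedConj i :=
  cs.lift_apply_simple cs.isLiftable_signedConj i

theorem signedConjHom_apply (w : W) (t : W) (e : ZMod 2) :
    cs.signedConjHom w (t, e) = (w * t * w⁻¹, e + (cs.signedConjHom w (t, 0)).2) := by
  induction w using cs.simple_induction_left generalizing t e with
  | one => simp [Function.End.one_def]
  | mul_simple_left w i ih =>
    rw [map_mul, endMul_apply, endMul_apply, ih t e, ih t 0,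
      signedConjHom_simple]
    simp [signedConj, mul_assoc, add_assoc]

/-- The inversion cocycle: `cs.inversionParity w t = 1` iff `t` is a left inversion of `w`. -/
noncomputable def inversionParity (w t : W) : ZMod 2 := (cs.signedConjHom w⁻¹ (t, 0)).2

theorem inversionParity_mul (x y t : W) : cs.inversionParity (x * y) t =
    cs.inversionParity x t + cs.inversionParity y (x⁻¹ * t * x) := by
  rw [inversionParity, mul_inv_rev, map_mul, endMul_apply,
    cs.signedConjHom_apply x⁻¹, cs.signedConjHom_apply y⁻¹]
  simp [inversionParity]

open scoped Classical in
theorem inversionParity_simple (i : B) (t : W) :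
    cs.inversionParity (cs.simple i) t = if t = cs.simple i then 1 else 0 := by
  simp [inversionParity, signedConjHom_simple, signedConj]

theorem inversionParity_one (t : W) : cs.inversionParity 1 t = 0 := by
  simp [inversionParity, Function.End.one_def]

open scoped Classical in
theorem inversionParity_wordProd (ω : List B) (t : W) :
    cs.inversionParity (cs.wordProd ω) t = ((cs.leftInvSeq ω).count t : ZMod 2) := by
  induction ω generalizing t with
  | nil => simp [inversionParity_one]
  | cons i ω ih =>
    rw [wordProd_cons, inversionParity_mul, inversionParity_simple, ih, leftInvSeq,
      List.count_cons]
    have : t = MulAut.conj (cs.simple i) ((cs.simple i)⁻¹ * t * cs.simple i) := by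
      simp [mul_assoc]
    have hcount := List.count_map_of_injective (cs.leftInvSeq ω) _
      (MulAut.conj (cs.simple i)).injective ((cs.simple i)⁻¹ * t * cs.simple i)
    rw [← this] at hcount
    rw [hcount]
    simp only [beq_iff_eq, eq_comm (a := t)]
    push_cast
    ring

/-- The set of left inversions of `w`. -/
def invSet (w : W) : Set W := {t | cs.inversionParity w t = 1}

theorem mem_invSet_wordProd {ω : List B} (hω : cs.IsReduced ω) {t : W} :
    t ∈ cs.invSet (cs.wordProd ω) ↔ t ∈ cs.leftInvSeq ω := by
  classical
  rw [invSet, Set.mem_ofPred, inversionParity_wordProd, hω.nodup_leftInvSeq.count]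
  split_ifs with h <;> simp [h]

theorem mem_invSet_mul {x y t : W} :
    t ∈ cs.invSet (x * y) ↔ ¬ (t ∈ cs.invSet x ↔ x⁻¹ * t * x ∈ cs.invSet y) := by
  have : ∀ a b : ZMod 2, a + b = 1 ↔ ¬ (a = 1 ↔ b = 1) := by decide
  simp only [invSet, Set.mem_ofPred, inversionParity_mul, this]

theorem mem_invSet_simple {i : B} {t : W} : t ∈ cs.invSet (cs.simple i) ↔ t = cs.simple i := by
  classical
  simp [invSet, inversionParity_simple]

theorem invSet_one : cs.invSet 1 = ∅ := by
  ext t; simp [invSet, inversionParity_one]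

theorem length_mul_lt_of_mem_invSet {w t : W} (h : t ∈ cs.invSet w) :
    cs.length (t * w) < cs.length w := by
  obtain ⟨ω, hω, rfl⟩ := cs.exists_isReduced w
  exact (cs.isLeftInversion_of_mem_leftInvSeq hω ((cs.mem_invSet_wordProd hω).1 h)).2

/-- By the cocycle rule s lies in exactly one of N(w) and N(sw), and an inversion shortens. -/
theorem simple_mem_invSet_iff {w : W} {i : B} :
    cs.simple i ∈ cs.invSet w ↔ cs.IsLeftDescent w i := by
  refine ⟨cs.length_mul_lt_of_mem_invSet, fun h => ?_⟩
  by_contra hn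
  have h1 : cs.simple i ∈ cs.invSet (cs.simple i * w) := by
    rw [mem_invSet_mul, mem_invSet_simple]
    simp [hn]
  have h2 := cs.length_mul_lt_of_mem_invSet h1
  rw [simple_mul_simple_cancel_left] at h2
  exact lt_asymm h h2

theorem rightWeakLE_iff_length {u w : W} :
    cs.RightWeakLE u w ↔ cs.length u + cs.length (u⁻¹ * w) = cs.length w := by
  constructor
  · rintro ⟨μ, ν, hμ, hν, rfl, rfl, ρ, rfl⟩
    have hρ : cs.IsReduced ρ := by simpa using hν.drop μ.length
    rw [hν.eq, wordProd_append, inv_mul_cancel_left, hμ.eq, hρ.eq, List.length_append]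
  · intro h
    obtain ⟨μ, hμ, hu⟩ := cs.exists_isReduced u
    obtain ⟨ρ, hρ, hr⟩ := cs.exists_isReduced (u⁻¹ * w)
    have hw : cs.wordProd (μ ++ ρ) = w := by rw [wordProd_append, ← hu, ← hr]; simp
    refine ⟨μ, μ ++ ρ, hμ, ?_, hu.symm, hw, List.prefix_append _ _⟩
    rw [IsReduced, hw, ← h, List.length_append, hr, hρ.eq, hu, hμ.eq]

theorem leftWeakLE_iff_inv {u w : W} : cs.LeftWeakLE u w ↔ cs.RightWeakLE u⁻¹ w⁻¹ := by
  constructor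
  · rintro ⟨μ, ν, hμ, hν, rfl, rfl, h⟩
    exact ⟨μ.reverse, ν.reverse, hμ.reverse, hν.reverse, by simp, by simp,
      List.reverse_prefix.2 h⟩
  · rintro ⟨μ, ν, hμ, hν, hu, hw, h⟩
    exact ⟨μ.reverse, ν.reverse, hμ.reverse, hν.reverse, by simp [hu], by simp [hw],
      List.reverse_suffix.2 h⟩

theorem RightWeakLE.invSet_subset {u w : W} (h : cs.RightWeakLE u w) :
    cs.invSet u ⊆ cs.invSet w := by
  obtain ⟨μ, ν, hμ, hν, rfl, rfl, ρ, rfl⟩ := h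
  intro t ht
  rw [mem_invSet_wordProd _ hμ] at ht
  rw [mem_invSet_wordProd _ hν]
  have : cs.leftInvSeq μ = (cs.leftInvSeq (μ ++ ρ)).take μ.length := by
    rw [← leftInvSeq_take]; simp
  rw [this] at ht
  exact List.mem_of_mem_take ht

/-- For the converse, a left descent s of u is also one of w by the inclusion; removing s from both
preserves the inclusion, and induction on the length applies. -/
theorem rightWeakLE_iff_invSet {u w : W} :
    cs.RightWeakLE u w ↔ cs.invSet u ⊆ cs.invSet w := by
  refine ⟨fun h => h.invSet_subset, fun h => ?_⟩
  rw [rightWeakLE_iff_length]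
  induction hn : cs.length u using Nat.strong_induction_on generalizing u w with
  | _ n ih =>
    subst hn
    by_cases hu : u = 1
    · simp [hu]
    obtain ⟨i, hi⟩ := cs.exists_leftDescent_of_ne_one hu
    have hw : cs.IsLeftDescent w i :=
      cs.simple_mem_invSet_iff.1 (h (cs.simple_mem_invSet_iff.2 hi))
    have hsub : cs.invSet (cs.simple i * u) ⊆ cs.invSet (cs.simple i * w) := by
      intro t
      rw [mem_invSet_mul, mem_invSet_mul, mem_invSet_simple, inv_simple]
      by_cases ht : t = cs.simple i
      · subst ht
        simp [cs.simple_mem_invSet_iff, hi, hw]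
      · simp only [ht, false_iff, not_not]
        exact fun h' => h h'
    have := ih _ hi hsub rfl
    rw [mul_inv_rev, mul_assoc, inv_simple, simple_mul_simple_cancel_left] at this
    rw [isLeftDescent_iff] at hi hw
    omega

theorem invSet_injective {u w : W} (h : cs.invSet u = cs.invSet w) : u = w := by
  have h1 := cs.rightWeakLE_iff_length.1 (cs.rightWeakLE_iff_invSet.2 h.le)
  have h2 := cs.rightWeakLE_iff_length.1 (cs.rightWeakLE_iff_invSet.2 h.ge)
  have : cs.length (u⁻¹ * w) = 0 := by omega
  rw [length_eq_zero_iff] at this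
  exact inv_mul_eq_one.1 this

end Inversions

/-! ### Parabolic subgroups and minimal coset representatives. -/

section Parabolic

variable {B W : Type*} [Group W] {M : CoxeterMatrix B} (cs : CoxeterSystem M W)

theorem RightWeakLE.trans {u v w : W} (h : cs.RightWeakLE u v) (h' : cs.RightWeakLE v w) :
    cs.RightWeakLE u w :=
  cs.rightWeakLE_iff_invSet.2 (h.invSet_subset.trans h'.invSet_subset)

theorem RightWeakLE.antisymm {u v : W} (h : cs.RightWeakLE u v) (h' : cs.RightWeakLE v u) :
    u = v :=
  cs.invSet_injective (h.invSet_subset.antisymm h'.invSet_subset)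

theorem rightWeakLE_refl (w : W) : cs.RightWeakLE w w :=
  cs.rightWeakLE_iff_invSet.2 le_rfl

theorem parabolic_mono {J K : Set B} (h : J ⊆ K) : cs.parabolic J ≤ cs.parabolic K :=
  Subgroup.closure_mono (Set.image_mono h)

theorem simple_mem_parabolic {J : Set B} {j : B} (h : j ∈ J) : cs.simple j ∈ cs.parabolic J :=
  Subgroup.subset_closure ⟨j, h, rfl⟩

theorem parabolic_empty : cs.parabolic ∅ = ⊥ := by simp [parabolic]

theorem parabolic_univ : cs.parabolic Set.univ = ⊤ := by
  rw [parabolic, Set.image_univ, cs.subgroup_closure_range_simple]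

theorem parabolic_iUnion {ι : Sort*} (J : ι → Set B) :
    cs.parabolic (⋃ a, J a) = ⨆ a, cs.parabolic (J a) := by
  simp only [parabolic, Set.image_iUnion, Subgroup.closure_iUnion]

theorem invSet_subset_parabolic {J : Set B} {y : W} (hy : y ∈ cs.parabolic J) :
    cs.invSet y ⊆ cs.parabolic J := by
  induction hy using Subgroup.closure_induction with
  | mem x hx =>
    obtain ⟨j, hj, rfl⟩ := hx
    intro t ht
    rw [mem_invSet_simple] at ht
    exact ht ▸ cs.simple_mem_parabolic hj
  | one => simp [invSet_one]
  | mul x y hx' _ hx hy =>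
    intro t ht
    rw [mem_invSet_mul] at ht
    by_cases h : t ∈ cs.invSet x
    · exact hx h
    · have h1 := hy (show x⁻¹ * t * x ∈ cs.invSet y by tauto)
      have hx'' : x ∈ cs.parabolic J := hx'
      have := Subgroup.mul_mem _ (Subgroup.mul_mem _ hx'' h1) (Subgroup.inv_mem _ hx'')
      simpa [mul_assoc] using this
  | inv x hx' hx =>
    intro t ht
    have h1 : t ∉ cs.invSet (x⁻¹ * x) := by simp [invSet_one]
    rw [mem_invSet_mul, not_not] at h1
    have h2 := hx (h1.1 ht)
    have hx'' : x ∈ cs.parabolic J := hx'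
    have := Subgroup.mul_mem _ (Subgroup.mul_mem _ (Subgroup.inv_mem _ hx'') h2) hx''
    simpa [mul_assoc] using this

/-- The left descents of an element of `W_J` lie in `J`. -/
theorem IsLeftDescent.mem_of_mem_parabolic {J : Set B} {y : W} (hy : y ∈ cs.parabolic J) {i : B}
    (hi : cs.IsLeftDescent y i) : i ∈ J :=
  cs.simple_mem_parabolic_iff.1 (cs.invSet_subset_parabolic hy (cs.simple_mem_invSet_iff.2 hi))

/-- Left descents of an element of both subgroups lie in J and in K, so they can be stripped off one
by one. -/
theorem parabolic_inter (J K : Set B) :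
    cs.parabolic (J ∩ K) = cs.parabolic J ⊓ cs.parabolic K := by
  refine le_antisymm (le_inf (cs.parabolic_mono Set.inter_subset_left)
    (cs.parabolic_mono Set.inter_subset_right)) fun y hy => ?_
  induction hn : cs.length y using Nat.strong_induction_on generalizing y with
  | _ n ih =>
    subst hn
    by_cases h1 : y = 1
    · rw [h1]; exact one_mem _
    obtain ⟨i, hi⟩ := cs.exists_leftDescent_of_ne_one h1
    have hJ := hi.mem_of_mem_parabolic cs hy.1
    have hK := hi.mem_of_mem_parabolic cs hy.2
    have h2 := ih _ hi (cs.simple i * y)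
      (mul_mem (Subgroup.mem_inf.2 ⟨cs.simple_mem_parabolic hJ, cs.simple_mem_parabolic hK⟩) hy) rfl
    have h3 := mul_mem (cs.simple_mem_parabolic (J := J ∩ K) ⟨hJ, hK⟩) h2
    rwa [simple_mul_simple_cancel_left] at h3

theorem exists_minLength_leftCoset (J : Set B) (w : W) : ∃ v : W, w * v⁻¹ ∈ cs.parabolic J ∧
    ∀ z : W, w * z⁻¹ ∈ cs.parabolic J → cs.length v ≤ cs.length z := by
  obtain ⟨v, hv, hmin⟩ := WellFounded.has_min (measure cs.length).wf
    {v : W | w * v⁻¹ ∈ cs.parabolic J} ⟨w, by simp⟩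
  exact ⟨v, hv, fun z hz => not_lt.1 (hmin z hz)⟩

/-- An element v' of minimal length in W_J v has no inversion t in W_J, since t v' would be shorter
in the same coset. If v ≠ v', a left descent of v v'⁻¹ ∈ W_J would be a left descent of v in J. -/
theorem disjoint_invSet_parabolic {J : Set B} {v : W} (hv : ∀ j ∈ J, ¬ cs.IsLeftDescent v j)
    {t : W} (ht : t ∈ cs.parabolic J) : t ∉ cs.invSet v := by
  obtain ⟨v', hv', hmin⟩ := cs.exists_minLength_leftCoset J v
  have hdisj : ∀ t ∈ cs.parabolic J, t ∉ cs.invSet v' := by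
    intro t ht h
    refine (cs.length_mul_lt_of_mem_invSet h).not_ge (hmin _ ?_)
    rw [mul_inv_rev, ← mul_assoc]
    exact mul_mem hv' (inv_mem ht)
  obtain rfl | hne := eq_or_ne v v'
  · exact hdisj t ht
  · obtain ⟨i, hi⟩ := cs.exists_leftDescent_of_ne_one (fun h => hne (mul_inv_eq_one.1 h))
    have hiJ := hi.mem_of_mem_parabolic cs hv'
    refine absurd ?_ (hv i hiJ)
    rw [← simple_mem_invSet_iff] at hi ⊢
    have h1 := hdisj _ (mul_mem (mul_mem (inv_mem hv') (cs.simple_mem_parabolic hiJ)) hv')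
    have h2 : v = (v * v'⁻¹) * v' := by simp
    rw [h2, mem_invSet_mul]
    tauto

theorem leftRep_spec (J : Set B) (w : W) : w * (cs.leftRep J w)⁻¹ ∈ cs.parabolic J ∧
    ∀ j ∈ J, ¬ cs.IsLeftDescent (cs.leftRep J w) j :=
  (cs.exists_leftRep J w).choose_spec

theorem rightRep_spec (K : Set B) (w : W) : (cs.rightRep K w)⁻¹ * w ∈ cs.parabolic K ∧
    ∀ k ∈ K, ¬ cs.IsRightDescent (cs.rightRep K w) k :=
  (cs.exists_rightRep K w).choose_spec

theorem leftRep_eq {J : Set B} {v w : W} (h : w * v⁻¹ ∈ cs.parabolic J)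
    (hv : ∀ j ∈ J, ¬ cs.IsLeftDescent v j) : cs.leftRep J w = v := by
  obtain ⟨h', hv'⟩ := cs.leftRep_spec J w
  set u := cs.leftRep J w
  by_contra hne
  obtain ⟨i, hi⟩ := cs.exists_leftDescent_of_ne_one (fun h => hne (mul_inv_eq_one.1 h))
  have hy : u * v⁻¹ ∈ cs.parabolic J := by
    have := mul_mem (inv_mem h') h
    simpa [mul_assoc] using this
  have hiJ := hi.mem_of_mem_parabolic cs hy
  have hsi := cs.simple_mem_parabolic hiJ
  have h1 := cs.disjoint_invSet_parabolic hv (mul_mem (mul_mem (inv_mem hy) hsi) hy)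
  have h2 := cs.disjoint_invSet_parabolic hv' hsi
  have h3 : u = (u * v⁻¹) * v := by simp
  rw [← simple_mem_invSet_iff] at hi
  rw [h3, mem_invSet_mul] at h2
  tauto

theorem rightRep_eq_inv (K : Set B) (w : W) : cs.rightRep K w = (cs.leftRep K w⁻¹)⁻¹ := by
  obtain ⟨h, hv⟩ := cs.rightRep_spec K w
  rw [eq_comm, inv_eq_iff_eq_inv]
  refine cs.leftRep_eq ?_ fun j hj => ?_
  · simpa using inv_mem h
  · rw [isLeftDescent_inv_iff]; exact hv j hj

theorem leftRep_eq_inv (J : Set B) (w : W) : cs.leftRep J w = (cs.rightRep J w⁻¹)⁻¹ := by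
  simp [rightRep_eq_inv]

theorem rightRep_eq {K : Set B} {v w : W} (h : v⁻¹ * w ∈ cs.parabolic K)
    (hv : ∀ k ∈ K, ¬ cs.IsRightDescent v k) : cs.rightRep K w = v := by
  rw [rightRep_eq_inv, inv_eq_iff_eq_inv]
  refine cs.leftRep_eq ?_ fun j hj => ?_
  · simpa using inv_mem h
  · rw [isLeftDescent_inv_iff]; exact hv j hj

theorem length_leftRep_le {J : Set B} {w z : W} (h : w * z⁻¹ ∈ cs.parabolic J) :
    cs.length (cs.leftRep J w) ≤ cs.length z := by
  obtain ⟨v, hv, hmin⟩ := cs.exists_minLength_leftCoset J w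
  rw [cs.leftRep_eq hv]
  · exact hmin z h
  · intro j hj hlt
    refine hlt.not_ge (hmin _ ?_)
    rw [mul_inv_rev, ← mul_assoc]
    exact mul_mem hv (inv_mem (cs.simple_mem_parabolic hj))

theorem length_rightRep_le {K : Set B} {w z : W} (h : z⁻¹ * w ∈ cs.parabolic K) :
    cs.length (cs.rightRep K w) ≤ cs.length z := by
  rw [rightRep_eq_inv, length_inv, ← cs.length_inv z]
  refine cs.length_leftRep_le ?_
  simpa using inv_mem h

theorem rightRep_eq_self_iff {K : Set B} {w : W} :
    cs.rightRep K w = w ↔ ∀ k ∈ K, ¬ cs.IsRightDescent w k := by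
  constructor
  · intro h
    have := (cs.rightRep_spec K w).2
    rwa [h] at this
  · exact fun h => cs.rightRep_eq (by simp) h

theorem rightRep_empty (w : W) : cs.rightRep ∅ w = w := by simp [rightRep_eq_self_iff]

theorem rightRep_univ (w : W) : cs.rightRep Set.univ w = 1 :=
  cs.rightRep_eq (by simp [parabolic_univ]) fun _ _ => cs.not_isRightDescent_one _

theorem rightRep_rightRep {K L : Set B} (h : K ⊆ L) (w : W) :
    cs.rightRep L (cs.rightRep K w) = cs.rightRep L w := by
  obtain ⟨h1, h2⟩ := cs.rightRep_spec L (cs.rightRep K w)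
  refine (cs.rightRep_eq ?_ h2).symm
  have := mul_mem h1 (cs.parabolic_mono h (cs.rightRep_spec K w).1)
  simpa [mul_assoc] using this

end Parabolic

/-! ### Blocks, their unions and intersections, and the inversions left after cutting. -/

section Blocks

variable {B W : Type*} [Group W] {M : CoxeterMatrix B} (cs : CoxeterSystem M W)

/-- `w W_K w⁻¹ = W_J`. -/
def IsBlockPair (w : W) (J K : Set B) : Prop :=
  (cs.parabolic K).map (MulAut.conj w).toMonoidHom = cs.parabolic J

theorem isBlockPair_iff {w : W} {J K : Set B} : cs.IsBlockPair w J K ↔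
    ({w} : Set W) * (cs.parabolic K : Set W) = (cs.parabolic J : Set W) * {w} := by
  rw [IsBlockPair, ← SetLike.coe_set_eq, Subgroup.coe_map, Set.singleton_mul, Set.mul_singleton]
  constructor
  · intro h
    rw [← h, Set.image_image]
    simp
  · intro h
    have h' := congrArg (fun S => (· * w⁻¹) '' S) h
    simp only [Set.image_image, mul_inv_cancel_right, Set.image_id'] at h'
    exact h'

theorem isRightBlock_iff {w : W} {K : Set B} :
    cs.IsRightBlock w K ↔ ∃ J, cs.IsBlockPair w J K := by
  simp only [IsRightBlock, isBlockPair_iff]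

variable {cs} {w : W} {J J' K K' L : Set B}

theorem IsBlockPair.isRightBlock (h : cs.IsBlockPair w J K) : cs.IsRightBlock w K :=
  cs.isRightBlock_iff.2 ⟨J, h⟩

theorem IsBlockPair.mem_iff (h : cs.IsBlockPair w J K) (x : W) :
    x ∈ cs.parabolic J ↔ w⁻¹ * x * w ∈ cs.parabolic K := by
  rw [← h, Subgroup.mem_map]
  constructor
  · rintro ⟨y, hy, rfl⟩
    simpa [mul_assoc] using hy
  · exact fun h => ⟨_, h, by simp [mul_assoc]⟩

theorem IsBlockPair.inv (h : cs.IsBlockPair w J K) : cs.IsBlockPair w⁻¹ K J := by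
  rw [IsBlockPair, ← h, Subgroup.map_map]
  convert Subgroup.map_id _
  ext x
  simp [mul_assoc]

theorem isLeftBlock_iff : cs.IsLeftBlock w J ↔ cs.IsRightBlock w⁻¹ J := by
  rw [isRightBlock_iff, IsLeftBlock]
  simp only [← isBlockPair_iff]
  exact ⟨fun ⟨K, h⟩ => ⟨K, h.inv⟩, fun ⟨K, h⟩ => ⟨K, by simpa using h.inv⟩⟩

theorem IsBlockPair.iUnion {ι : Sort*} {J K : ι → Set B}
    (h : ∀ a, cs.IsBlockPair w (J a) (K a)) : cs.IsBlockPair w (⋃ a, J a) (⋃ a, K a) := by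
  rw [IsBlockPair, parabolic_iUnion, parabolic_iUnion, Subgroup.map_iSup]
  exact iSup_congr h

theorem IsBlockPair.inter (h : cs.IsBlockPair w J K) (h' : cs.IsBlockPair w J' K') :
    cs.IsBlockPair w (J ∩ J') (K ∩ K') := by
  rw [IsBlockPair, parabolic_inter, parabolic_inter,
    Subgroup.map_inf _ _ _ (MulAut.conj w).injective, h, h']

theorem IsBlockPair.union (h : cs.IsBlockPair w J K) (h' : cs.IsBlockPair w J' K') :
    cs.IsBlockPair w (J ∪ J') (K ∪ K') := by
  rw [Set.union_eq_iUnion, Set.union_eq_iUnion]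
  exact .iUnion (Bool.forall_bool.2 ⟨h', h⟩)

theorem IsBlockPair.congr_coset {z : W} (h : cs.IsBlockPair w J K)
    (hz : z⁻¹ * w ∈ cs.parabolic K) : cs.IsBlockPair z J K := by
  rw [IsBlockPair, ← h]
  have hwz : w = z * (z⁻¹ * w) := by simp
  ext x
  constructor
  · rintro ⟨y, hy, rfl⟩
    refine ⟨(z⁻¹ * w)⁻¹ * y * (z⁻¹ * w), mul_mem (mul_mem (inv_mem hz) hy) hz, ?_⟩
    simp [mul_assoc]
  · rintro ⟨y, hy, rfl⟩
    refine ⟨(z⁻¹ * w) * y * (z⁻¹ * w)⁻¹, mul_mem (mul_mem hz hy) (inv_mem hz), ?_⟩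
    simp [mul_assoc]

/-- The cosets w W_K and W_J w coincide, and w^K has minimal length there, so it has no left descent
in J. -/
theorem IsBlockPair.rightRep_eq_leftRep (h : cs.IsBlockPair w J K) :
    cs.rightRep K w = cs.leftRep J w := by
  obtain ⟨h1, -⟩ := cs.rightRep_spec K w
  have hJ : w * (cs.rightRep K w)⁻¹ ∈ cs.parabolic J := by
    rw [h.mem_iff]
    simpa [mul_assoc] using h1
  refine (cs.leftRep_eq hJ fun j hj hlt => hlt.not_ge (cs.length_rightRep_le ?_)).symm
  have h2 := (h.mem_iff _).1 (mul_mem hJ (inv_mem (cs.simple_mem_parabolic hj)))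
  simpa [mul_assoc] using h2

theorem IsBlockPair.inv_rightRep (h : cs.IsBlockPair w J K) :
    (cs.rightRep K w)⁻¹ = cs.rightRep J w⁻¹ := by
  rw [h.rightRep_eq_leftRep, leftRep_eq_inv, inv_inv]

/-- Write w = w^K x. The cocycle rule gives N(w) = N(w^K) △ w^K N(x) (w^K)⁻¹; the second set lies in
W_J, and N(w^K) avoids W_J. -/
theorem IsBlockPair.invSet_rightRep (h : cs.IsBlockPair w J K) :
    cs.invSet (cs.rightRep K w) = cs.invSet w \ cs.parabolic J := by
  ext t
  rw [Set.mem_sdiff, SetLike.mem_coe]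
  by_cases ht : t ∈ cs.parabolic J
  · simp only [ht, not_true_eq_false, and_false, iff_false]
    rw [h.rightRep_eq_leftRep]
    exact cs.disjoint_invSet_parabolic (cs.leftRep_spec J w).2 ht
  · simp only [ht, not_false_eq_true, and_true]
    obtain ⟨h1, -⟩ := cs.rightRep_spec K w
    have h2 : w = cs.rightRep K w * ((cs.rightRep K w)⁻¹ * w) := by simp
    have h3 : (cs.rightRep K w)⁻¹ * t * cs.rightRep K w ∉
        cs.invSet ((cs.rightRep K w)⁻¹ * w) := by
      intro h4
      apply ht
      have hb := h.congr_coset (z := cs.rightRep K w) h1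
      exact (hb.mem_iff t).2 (cs.invSet_subset_parabolic h1 h4)
    conv_rhs => rw [h2, mem_invSet_mul]
    tauto

variable (cs) in
theorem isBlockPair_empty (w : W) : cs.IsBlockPair w ∅ ∅ := by
  simp [IsBlockPair, parabolic_empty]

variable (cs) in
theorem isBlockPair_univ (w : W) : cs.IsBlockPair w Set.univ Set.univ := by
  rw [IsBlockPair, parabolic_univ]
  exact Subgroup.map_top_of_surjective _ (MulAut.conj w).surjective

theorem IsRightBlock.rightRep_le (h : cs.IsRightBlock w K) :
    cs.RightWeakLE (cs.rightRep K w) w := by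
  obtain ⟨J, hJ⟩ := cs.isRightBlock_iff.1 h
  rw [rightWeakLE_iff_invSet, hJ.invSet_rightRep]
  exact Set.sdiff_subset

theorem IsRightBlock.rightRep_antitone (hK : cs.IsRightBlock w K) (hL : cs.IsRightBlock w L)
    (h : K ⊆ L) : cs.RightWeakLE (cs.rightRep L w) (cs.rightRep K w) := by
  obtain ⟨J, hJ⟩ := cs.isRightBlock_iff.1 hK
  obtain ⟨J', hJ'⟩ := cs.isRightBlock_iff.1 hL
  rw [rightWeakLE_iff_invSet, hJ.invSet_rightRep, hJ'.invSet_rightRep]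
  refine Set.sdiff_subset_sdiff_right fun x hx => ?_
  exact (hJ'.mem_iff x).2 (cs.parabolic_mono h ((hJ.mem_iff x).1 hx))

theorem IsRightBlock.inter (h : cs.IsRightBlock w K) (h' : cs.IsRightBlock w K') :
    cs.IsRightBlock w (K ∩ K') := by
  rw [isRightBlock_iff] at *
  exact ⟨_, h.choose_spec.inter h'.choose_spec⟩

theorem IsRightBlock.iUnion {ι : Sort*} {K : ι → Set B} (h : ∀ a, cs.IsRightBlock w (K a)) :
    cs.IsRightBlock w (⋃ a, K a) := by
  simp only [isRightBlock_iff] at h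
  choose J hJ using h
  exact (IsBlockPair.iUnion hJ).isRightBlock

theorem IsRightBlock.union (h : cs.IsRightBlock w K) (h' : cs.IsRightBlock w K') :
    cs.IsRightBlock w (K ∪ K') := by
  rw [isRightBlock_iff] at *
  exact ⟨_, h.choose_spec.union h'.choose_spec⟩

theorem IsRightBlock.congr_coset {z : W} (h : cs.IsRightBlock w K)
    (hz : z⁻¹ * w ∈ cs.parabolic K) : cs.IsRightBlock z K := by
  rw [isRightBlock_iff] at *
  exact ⟨_, h.choose_spec.congr_coset hz⟩

/-- `w^{⋃ K_a}` is the meet of `w` and the `w^{K_a}` in right weak order. -/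
theorem IsRightBlock.le_rightRep_iUnion {ι : Sort*} {K : ι → Set B}
    (h : ∀ a, cs.IsRightBlock w (K a)) {t : W} (ht : cs.RightWeakLE t w)
    (hta : ∀ a, cs.RightWeakLE t (cs.rightRep (K a) w)) :
    cs.RightWeakLE t (cs.rightRep (⋃ a, K a) w) := by
  simp only [isRightBlock_iff] at h
  choose J hJ using h
  rw [rightWeakLE_iff_invSet, (IsBlockPair.iUnion hJ).invSet_rightRep]
  intro x hx
  refine ⟨ht.invSet_subset cs hx, fun hxJ => ?_⟩
  -- If N(t) met W_J, t would have a left descent in some `J a`, contrary to t ≤_R w^{K_a}.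
  refine cs.disjoint_invSet_parabolic (fun j hj hd => ?_) hxJ hx
  obtain ⟨a, ha⟩ := Set.mem_iUnion.1 hj
  have h1 := (hta a).invSet_subset cs (cs.simple_mem_invSet_iff.2 hd)
  rw [(hJ a).invSet_rightRep] at h1
  exact h1.2 (cs.simple_mem_parabolic ha)

theorem IsRightBlock.le_rightRep_union (h : cs.IsRightBlock w K) (h' : cs.IsRightBlock w K')
    {t : W} (ht : cs.RightWeakLE t (cs.rightRep K w))
    (ht' : cs.RightWeakLE t (cs.rightRep K' w)) :
    cs.RightWeakLE t (cs.rightRep (K ∪ K') w) := by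
  rw [Set.union_eq_iUnion]
  refine le_rightRep_iUnion (fun b => ?_) (RightWeakLE.trans cs ht h.rightRep_le) (fun b => ?_)
  · cases b <;> assumption
  · cases b <;> assumption

/-- `w^{K ∩ K'}` is the join of `w^K` and `w^{K'}` in right weak order. -/
theorem IsRightBlock.rightRep_inter_le (h : cs.IsRightBlock w K) (h' : cs.IsRightBlock w K')
    {t : W} (ht : cs.RightWeakLE (cs.rightRep K w) t)
    (ht' : cs.RightWeakLE (cs.rightRep K' w) t) :
    cs.RightWeakLE (cs.rightRep (K ∩ K') w) t := by
  obtain ⟨J, hJ⟩ := cs.isRightBlock_iff.1 h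
  obtain ⟨J', hJ'⟩ := cs.isRightBlock_iff.1 h'
  rw [rightWeakLE_iff_invSet, hJ.invSet_rightRep] at ht
  rw [rightWeakLE_iff_invSet, hJ'.invSet_rightRep] at ht'
  -- As W_{J ∩ J'} = W_J ∩ W_{J'}, the inversion set of w^{K ∩ K'} is the union of the other two.
  rw [rightWeakLE_iff_invSet, (hJ.inter hJ').invSet_rightRep, parabolic_inter]
  rintro x ⟨hx, hxJ⟩
  by_cases hxJ1 : x ∈ cs.parabolic J
  · exact ht' ⟨hx, fun h2 => hxJ ⟨hxJ1, h2⟩⟩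
  · exact ht ⟨hx, hxJ1⟩

/-- A cutting point may arise from several blocks. This lemma and `rightRep_union_eq` replace blocks
of comparable cutting points by nested ones. -/
theorem IsRightBlock.rightRep_inter_eq (h : cs.IsRightBlock w K) (h' : cs.IsRightBlock w K')
    (hle : cs.RightWeakLE (cs.rightRep K w) (cs.rightRep K' w)) :
    cs.rightRep (K ∩ K') w = cs.rightRep K' w :=
  RightWeakLE.antisymm cs (h.rightRep_inter_le h' hle (cs.rightWeakLE_refl _))
    ((h.inter h').rightRep_antitone h' Set.inter_subset_right)

theorem IsRightBlock.rightRep_union_eq (h : cs.IsRightBlock w K) (h' : cs.IsRightBlock w K')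
    (hle : cs.RightWeakLE (cs.rightRep K w) (cs.rightRep K' w)) :
    cs.rightRep (K ∪ K') w = cs.rightRep K w :=
  RightWeakLE.antisymm cs (h.rightRep_antitone (h.union h') Set.subset_union_left)
    (h.le_rightRep_union h' (cs.rightWeakLE_refl _) hle)

end Blocks

/-! ### The cutting relation and its intervals. -/

section Cutting

variable {B W : Type*} [Group W] {M : CoxeterMatrix B} {cs : CoxeterSystem M W} {u v w : W}
  {K K' L : Set B}

theorem IsRightBlock.cutLE (h : cs.IsRightBlock w K) : cs.CutLE (cs.rightRep K w) w := ⟨K, h, rfl⟩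

theorem CutLE.rightWeakLE (h : cs.CutLE u w) : cs.RightWeakLE u w := by
  obtain ⟨K, hK, rfl⟩ := h
  exact hK.rightRep_le

theorem CutLE.inv (h : cs.CutLE u w) : cs.CutLE u⁻¹ w⁻¹ := by
  obtain ⟨K, hK, rfl⟩ := h
  obtain ⟨J, hJ⟩ := cs.isRightBlock_iff.1 hK
  rw [hJ.inv_rightRep]
  exact hJ.inv.isRightBlock.cutLE

theorem CutLE.leftWeakLE (h : cs.CutLE u w) : cs.LeftWeakLE u w :=
  cs.leftWeakLE_iff_inv.2 h.inv.rightWeakLE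

theorem cutLE_rightRep_of_subset (hL : cs.IsRightBlock w L) (h : K ⊆ L) :
    cs.CutLE (cs.rightRep L w) (cs.rightRep K w) := by
  refine ⟨L, hL.congr_coset (cs.parabolic_mono h (cs.rightRep_spec K w).1), ?_⟩
  rw [rightRep_rightRep cs h]

/-- K is a block of w^K along which nothing is cut, so adding it to a block K' does not change the
result. The union L contains K, so w and w^K share the coset of W_L and L is also a block of w. -/
theorem CutLE.exists_superset (hK : cs.IsRightBlock w K) (h : cs.CutLE u (cs.rightRep K w)) :
    ∃ L, K ⊆ L ∧ cs.IsRightBlock w L ∧ u = cs.rightRep L w := by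
  obtain ⟨K', hK', rfl⟩ := h
  have h1 := (cs.rightRep_spec K w).1
  have h2 := hK'.union (hK.congr_coset h1)
  refine ⟨K' ∪ K, Set.subset_union_right, h2.congr_coset ?_, ?_⟩
  · have := inv_mem (cs.parabolic_mono (Set.subset_union_right (s := K')) h1)
    simpa using this
  · rw [← rightRep_rightRep cs Set.subset_union_right,
      hK'.rightRep_union_eq (hK.congr_coset h1)]
    rw [rightRep_rightRep cs subset_rfl]
    exact hK'.rightRep_le

theorem CutLE.trans (h : cs.CutLE u v) (h' : cs.CutLE v w) : cs.CutLE u w := by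
  obtain ⟨K, hK, rfl⟩ := h'
  obtain ⟨L, -, hL, rfl⟩ := h.exists_superset hK
  exact hL.cutLE

theorem CutLE.antisymm (h : cs.CutLE u v) (h' : cs.CutLE v u) : u = v :=
  RightWeakLE.antisymm cs h.rightWeakLE h'.rightWeakLE

variable (cs) in
theorem cutLE_refl (w : W) : cs.CutLE w w :=
  ⟨∅, (cs.isBlockPair_empty w).isRightBlock, (cs.rightRep_empty w).symm⟩

variable (cs) in
theorem one_cutLE (w : W) : cs.CutLE 1 w :=
  ⟨Set.univ, (cs.isBlockPair_univ w).isRightBlock, (cs.rightRep_univ w).symm⟩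

theorem CutLE.of_rightWeakLE (hu : cs.CutLE u w) (hv : cs.CutLE v w) (h : cs.RightWeakLE u v) :
    cs.CutLE u v := by
  obtain ⟨K, hK, rfl⟩ := hu
  obtain ⟨K', hK', rfl⟩ := hv
  rw [← hK.rightRep_union_eq hK' h]
  exact cutLE_rightRep_of_subset (hK.union hK') Set.subset_union_right

theorem CutLE.of_leftWeakLE (hu : cs.CutLE u w) (hv : cs.CutLE v w) (h : cs.LeftWeakLE u v) :
    cs.CutLE u v := by
  have := (hu.inv.of_rightWeakLE hv.inv (cs.leftWeakLE_iff_inv.1 h)).inv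
  simpa using this

theorem isMeetFor_rightWeakLE (hK : cs.IsRightBlock w K) (hK' : cs.IsRightBlock w K') :
    IsMeetFor cs.RightWeakLE (cs.rightRep K w) (cs.rightRep K' w) (cs.rightRep (K ∪ K') w) := by
  refine ⟨?_, fun t ht => hK.le_rightRep_union hK' (ht (by simp)) (ht (by simp))⟩
  rintro _ (rfl | rfl)
  · exact hK.rightRep_antitone (hK.union hK') Set.subset_union_left
  · exact hK'.rightRep_antitone (hK.union hK') Set.subset_union_right

theorem isJoinFor_rightWeakLE (hK : cs.IsRightBlock w K) (hK' : cs.IsRightBlock w K') :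
    IsJoinFor cs.RightWeakLE (cs.rightRep K w) (cs.rightRep K' w) (cs.rightRep (K ∩ K') w) := by
  refine ⟨?_, fun t ht => hK.rightRep_inter_le hK' (ht (by simp)) (ht (by simp))⟩
  rintro _ (rfl | rfl)
  · exact (hK.inter hK').rightRep_antitone hK Set.inter_subset_left
  · exact (hK.inter hK').rightRep_antitone hK' Set.inter_subset_right

theorem isMeetFor_leftWeakLE_of_inv {x y m : W}
    (h : IsMeetFor cs.RightWeakLE x⁻¹ y⁻¹ m⁻¹) : IsMeetFor cs.LeftWeakLE x y m := by
  refine ⟨?_, fun t ht => cs.leftWeakLE_iff_inv.2 (h.2 ?_)⟩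
  · rintro z hz
    refine cs.leftWeakLE_iff_inv.2 (h.1 ?_)
    rcases hz with rfl | rfl <;> simp
  · rintro z (rfl | rfl)
    · exact cs.leftWeakLE_iff_inv.1 (ht (by simp))
    · exact cs.leftWeakLE_iff_inv.1 (ht (by simp))

theorem isJoinFor_leftWeakLE_of_inv {x y j : W}
    (h : IsJoinFor cs.RightWeakLE x⁻¹ y⁻¹ j⁻¹) : IsJoinFor cs.LeftWeakLE x y j := by
  refine ⟨?_, fun t ht => cs.leftWeakLE_iff_inv.2 (h.2 ?_)⟩
  · rintro z hz
    refine cs.leftWeakLE_iff_inv.2 (h.1 ?_)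
    rcases hz with rfl | rfl <;> simp
  · rintro z (rfl | rfl)
    · exact cs.leftWeakLE_iff_inv.1 (ht (by simp))
    · exact cs.leftWeakLE_iff_inv.1 (ht (by simp))

theorem isMeetFor_leftWeakLE (hK : cs.IsRightBlock w K) (hK' : cs.IsRightBlock w K') :
    IsMeetFor cs.LeftWeakLE (cs.rightRep K w) (cs.rightRep K' w) (cs.rightRep (K ∪ K') w) := by
  obtain ⟨J, hJ⟩ := cs.isRightBlock_iff.1 hK
  obtain ⟨J', hJ'⟩ := cs.isRightBlock_iff.1 hK'
  apply isMeetFor_leftWeakLE_of_inv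
  rw [hJ.inv_rightRep, hJ'.inv_rightRep, (hJ.union hJ').inv_rightRep]
  exact isMeetFor_rightWeakLE hJ.inv.isRightBlock hJ'.inv.isRightBlock

theorem isJoinFor_leftWeakLE (hK : cs.IsRightBlock w K) (hK' : cs.IsRightBlock w K') :
    IsJoinFor cs.LeftWeakLE (cs.rightRep K w) (cs.rightRep K' w) (cs.rightRep (K ∩ K') w) := by
  obtain ⟨J, hJ⟩ := cs.isRightBlock_iff.1 hK
  obtain ⟨J', hJ'⟩ := cs.isRightBlock_iff.1 hK'
  apply isJoinFor_leftWeakLE_of_inv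
  rw [hJ.inv_rightRep, hJ'.inv_rightRep, (hJ.inter hJ').inv_rightRep]
  exact isJoinFor_rightWeakLE hJ.inv.isRightBlock hJ'.inv.isRightBlock

/-- Intervals of the cutting relation are closed under the meets and joins of both weak orders. -/
theorem CutLE.exists_meet_join {x y : W} (hux : cs.CutLE u x) (hxw : cs.CutLE x w)
    (huy : cs.CutLE u y) (hyw : cs.CutLE y w) :
    (∃ m, (cs.CutLE u m ∧ cs.CutLE m w) ∧
      IsMeetFor cs.RightWeakLE x y m ∧ IsMeetFor cs.LeftWeakLE x y m) ∧
    (∃ j, (cs.CutLE u j ∧ cs.CutLE j w) ∧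
      IsJoinFor cs.RightWeakLE x y j ∧ IsJoinFor cs.LeftWeakLE x y j) := by
  obtain ⟨K, hK, rfl⟩ := hxw
  obtain ⟨K', hK', rfl⟩ := hyw
  obtain ⟨L, hKL, hL, rfl⟩ := hux.exists_superset hK
  obtain ⟨L', hKL', hL', huL⟩ := huy.exists_superset hK'
  -- Both L and L' cut w down to u, hence so does their union, which contains both K and K'.
  have h : cs.rightRep L w = cs.rightRep (L ∪ L') w :=
    (hL.rightRep_union_eq hL' (huL ▸ cs.rightWeakLE_refl _)).symm
  have hsub : K ∪ K' ⊆ L ∪ L' := Set.union_subset_union hKL hKL'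
  rw [h]
  exact ⟨⟨_, ⟨cutLE_rightRep_of_subset (hL.union hL') hsub, (hK.union hK').cutLE⟩,
      isMeetFor_rightWeakLE hK hK', isMeetFor_leftWeakLE hK hK'⟩,
    ⟨_, ⟨cutLE_rightRep_of_subset (hL.union hL')
        ((Set.inter_subset_left.trans Set.subset_union_left).trans hsub), (hK.inter hK').cutLE⟩,
      isJoinFor_rightWeakLE hK hK', isJoinFor_leftWeakLE hK hK'⟩⟩

end Cutting

end CoxeterSystem

/-! ### Free meet-semilattices on lower covers and their Möbius function, for abstract posets. -/

section CoverMeets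

variable {α : Type*} [PartialOrder α] {w : α}

theorem exists_orderIso_of_range_eq {β : Type*} [PartialOrder β] {T : Set α} (g : β → α)
    (h : ∀ a b, g a ≤ g b ↔ a ≤ b) (hT : Set.range g = T) :
    ∃ φ : β ≃o T, ∀ a, (φ a : α) = g a := by
  subst hT
  exact ⟨(OrderEmbedding.ofMapLEIff g h).orderIso, fun _ => rfl⟩

theorem MemCoverMeets.map (e : α ≃o α) {u : α} (h : MemCoverMeets w u) :
    MemCoverMeets (e w) (e u) := by
  induction h with
  | top => exact .top
  | cover h => exact .cover ((apply_covBy_apply_iff e).2 h)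
  | meet _ _ h ha hb =>
    refine .meet ha hb ?_
    rwa [← Set.image_pair, e.isGLB_image']

theorem image_coverMeets (e : α ≃o α) : e '' coverMeets w = coverMeets (e w) := by
  ext u
  constructor
  · rintro ⟨u, hu, rfl⟩
    exact hu.map e
  · intro hu
    have h := MemCoverMeets.map e.symm hu
    rw [e.symm_apply_apply] at h
    exact ⟨e.symm u, h, by simp⟩

/-- A family of elements below `w` indexed by the subsets of the lower covers of `w` which
consists of the meets of these subsets, and which is free on the lower covers. -/
structure IsFreeMeet (φ : Set {u : α // u ⋖ w} → α) : Prop where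
  isGLB : ∀ A, IsGLB (insert w (Subtype.val '' A)) (φ A)
  mem_of_le : ∀ (A) (u : {u : α // u ⋖ w}), φ A ≤ u → u ∈ A

namespace IsFreeMeet

variable {φ : Set {u : α // u ⋖ w} → α}

theorem le_iff' (hφ : IsFreeMeet φ) {A : Set {u : α // u ⋖ w}} {z : α} :
    z ≤ φ A ↔ z ≤ w ∧ ∀ u ∈ A, z ≤ (u : α) := by
  rw [le_isGLB_iff (hφ.isGLB A)]
  simp [lowerBounds]

theorem le_iff (hφ : IsFreeMeet φ) {A A' : Set {u : α // u ⋖ w}} : φ A ≤ φ A' ↔ A' ⊆ A := by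
  have h := (hφ.le_iff' (A := A)).1 le_rfl
  rw [hφ.le_iff']
  exact ⟨fun h' u hu => hφ.mem_of_le A u (h'.2 u hu), fun h' => ⟨h.1, fun u hu => h.2 u (h' hu)⟩⟩

theorem apply_empty (hφ : IsFreeMeet φ) : φ ∅ = w :=
  le_antisymm (hφ.le_iff'.1 le_rfl).1 (hφ.le_iff'.2 (by simp))

theorem apply_singleton (hφ : IsFreeMeet φ) (u : {u : α // u ⋖ w}) : φ {u} = u :=
  le_antisymm ((hφ.le_iff'.1 le_rfl).2 u rfl) (hφ.le_iff'.2 ⟨u.2.le, by simp⟩)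

theorem isGLB_pair (hφ : IsFreeMeet φ) (A A' : Set {u : α // u ⋖ w}) : IsGLB {φ A, φ A'} (φ (A ∪ A')) := by
  refine ⟨?_, fun z hz => ?_⟩
  · rintro _ (rfl | rfl)
    · exact hφ.le_iff.2 Set.subset_union_left
    · exact hφ.le_iff.2 Set.subset_union_right
  · have h1 := hφ.le_iff'.1 (hz (show φ A ∈ _ by simp))
    have h2 := hφ.le_iff'.1 (hz (show φ A' ∈ _ by simp))
    exact hφ.le_iff'.2 ⟨h1.1, fun u hu => hu.elim (h1.2 u) (h2.2 u)⟩

theorem range_eq (hφ : IsFreeMeet φ) [Finite α] : Set.range φ = coverMeets w := by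
  ext u
  constructor
  · rintro ⟨A, rfl⟩
    induction A, A.toFinite using Set.Finite.induction_on with
    | empty => rw [hφ.apply_empty]; exact .top
    | @insert a A _ _ ih =>
      rw [Set.insert_eq]
      refine .meet ?_ ih (hφ.isGLB_pair _ _)
      rw [hφ.apply_singleton]
      exact .cover a.2
  · intro hu
    induction hu with
    | top => exact ⟨∅, hφ.apply_empty⟩
    | cover h => exact ⟨{⟨_, h⟩}, hφ.apply_singleton ⟨_, h⟩⟩
    | meet _ _ h ha hb =>
      obtain ⟨A, rfl⟩ := ha
      obtain ⟨A', rfl⟩ := hb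
      exact ⟨A ∪ A', (hφ.isGLB_pair A A').unique h⟩

end IsFreeMeet

open scoped Classical in
/-- The Möbius function is characterized by its recursion. -/
theorem IncidenceAlgebra.mu_eq_of_sum_Icc [Finite α] [LocallyFiniteOrder α] (f : α → ℤ)
    (hf : ∀ u ≤ w, ∑ z ∈ Finset.Icc u w, f z = if u = w then 1 else 0) (u : α) (hu : u ≤ w) :
    IncidenceAlgebra.mu ℤ u w = f u := by
  induction u using WellFoundedGT.induction with
  | ind u ih =>
    have h1 := IncidenceAlgebra.sum_Icc_mu_left (𝕜 := ℤ) u w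
    rw [← hf u hu, ← Finset.Ioc_insert_left hu, Finset.sum_insert (by simp),
      Finset.sum_insert (by simp)] at h1
    have h2 : ∑ z ∈ Finset.Ioc u w, IncidenceAlgebra.mu ℤ z w = ∑ z ∈ Finset.Ioc u w, f z :=
      Finset.sum_congr rfl fun z hz =>
        ih z (Finset.mem_Ioc.1 hz).1 (Finset.mem_Ioc.1 hz).2
    linarith

namespace IsFreeMeet

variable {φ : Set {u : α // u ⋖ w} → α}

open scoped Classical in
-- Summed over [u, w], the right-hand side becomes the alternating sum over subsets of the set of
-- lower covers above u. It vanishes unless that set is empty, which by finiteness means u = w.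
theorem moebiusFn_eq (hφ : IsFreeMeet φ) [Finite α] [Fintype {u : α // u ⋖ w}] (u : α) (hu : u ≤ w) :
    moebiusFn u w = ∑ A : Finset {u : α // u ⋖ w}, if φ A = u then (-1) ^ A.card else 0 := by
  rw [moebiusFn]
  let _ : Fintype α := Fintype.ofFinite α
  let _ : LocallyFiniteOrder α := Fintype.toLocallyFiniteOrder
  refine IncidenceAlgebra.mu_eq_of_sum_Icc
    (fun u => ∑ A : Finset {u : α // u ⋖ w}, if φ A = u then (-1) ^ A.card else 0) ?_ u hu
  intro u hu
  rw [Finset.sum_comm]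
  simp only [Finset.sum_ite_eq, Finset.mem_Icc]
  have h1 : ∀ A : Finset {u : α // u ⋖ w}, (u ≤ φ A ∧ φ A ≤ w) ↔
      A ∈ (Finset.univ.filter fun c : {u : α // u ⋖ w} => u ≤ c).powerset := by
    intro A
    have h2 : φ A ≤ w := (hφ.le_iff'.1 le_rfl).1
    simp only [h2, and_true, hφ.le_iff', hu, true_and, Finset.mem_powerset]
    simp [Finset.subset_iff]
  simp only [h1]
  rw [← Finset.sum_filter, Finset.filter_univ_mem, Finset.sum_powerset_neg_one_pow_card]
  refine if_congr ?_ rfl rfl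
  rw [Finset.filter_eq_empty_iff]
  constructor
  · intro h
    by_contra hne
    obtain ⟨c, huc, hc⟩ := exists_le_covBy_of_lt (lt_of_le_of_ne hu hne)
    exact h (x := ⟨c, hc⟩) (Finset.mem_univ _) huc
  · rintro rfl c - h
    exact c.2.lt.not_ge h

theorem moebiusFn_apply (hφ : IsFreeMeet φ) [Finite α] (A : Set {u : α // u ⋖ w}) :
    moebiusFn (φ A) w = (-1) ^ A.ncard := by
  classical
  let _ : Fintype {u : α // u ⋖ w} := Fintype.ofFinite _
  have hinj : ∀ A' : Finset {u : α // u ⋖ w}, φ A' = φ A ↔ A' = A.toFinset := by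
    intro A'
    rw [← Finset.coe_inj, Set.coe_toFinset]
    refine ⟨fun h => ?_, fun h => h ▸ rfl⟩
    exact (hφ.le_iff.1 h.ge).antisymm (hφ.le_iff.1 h.le)
  rw [hφ.moebiusFn_eq _ (hφ.le_iff'.1 le_rfl).1]
  simp only [hinj, Finset.sum_ite_eq', Finset.mem_univ, if_true]
  rw [Set.ncard_eq_toFinset_card']

theorem moebiusFn_eq_zero (hφ : IsFreeMeet φ) [Finite α] {u : α} (hu : u ∉ coverMeets w) : moebiusFn u w = 0 := by
  classical
  let _ : Fintype {u : α // u ⋖ w} := Fintype.ofFinite _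
  by_cases h : u ≤ w
  · rw [hφ.moebiusFn_eq u h]
    refine Finset.sum_eq_zero fun A _ => if_neg fun hA => hu ?_
    rw [← hφ.range_eq]
    exact ⟨_, hA⟩
  · exact IncidenceAlgebra.apply_eq_zero_of_not_le h _

end IsFreeMeet

end CoverMeets
namespace CoxeterSystem

/-! ### Lower covers and minimal nontrivial blocks. -/

section LowerCovers

variable {B W : Type*} [Group W] {M : CoxeterMatrix B} (cs : CoxeterSystem M W)

/-- The cutting order. -/
abbrev cuttingOrder : PartialOrder W where
  le := cs.CutLE
  le_refl := cs.cutLE_refl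
  le_trans _ _ _ := CutLE.trans
  le_antisymm _ _ := CutLE.antisymm

variable {cs} {w : W}

theorem isRightBlock_of_mem_minimal {K : Set B} (hK : K ∈ cs.minimalRightBlocks w) :
    cs.IsRightBlock w K :=
  (Set.mem_ofPred.1 hK).prop.1

theorem rightRep_ne_of_mem_minimal {K : Set B} (hK : K ∈ cs.minimalRightBlocks w) :
    cs.rightRep K w ≠ w :=
  (Set.mem_ofPred.1 hK).prop.2

theorem minimalLeftBlocks_eq (w : W) : cs.minimalLeftBlocks w = cs.minimalRightBlocks w⁻¹ := by
  ext J
  simp only [minimalLeftBlocks, minimalRightBlocks, Set.mem_ofPred, isLeftBlock_iff,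
    leftRep_eq_inv, ne_eq, inv_eq_iff_eq_inv]

variable [PartialOrder W]

theorem le_iff_rightWeakLE (hle : ∀ u w : W, u ≤ w ↔ cs.CutLE u w) {u v : W}
    (hu : u ≤ w) (hv : v ≤ w) : u ≤ v ↔ cs.RightWeakLE u v := by
  rw [hle] at *
  exact ⟨CutLE.rightWeakLE, hu.of_rightWeakLE hv⟩

theorem bijOn_minimalRightBlocks (hle : ∀ u w : W, u ≤ w ↔ cs.CutLE u w) [Finite B] (w : W) :
    Set.BijOn (fun K => cs.rightRep K w) (cs.minimalRightBlocks w) {u | u ⋖ w} := by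
  refine ⟨fun K hK => ?_, fun K hK K' hK' h => ?_, fun u hu => ?_⟩
  · obtain ⟨⟨hb, hne⟩, hmin⟩ := hK
    have hlt : cs.rightRep K w < w := lt_of_le_of_ne ((hle _ _).2 hb.cutLE) hne
    refine ⟨hlt, fun x hx hxw => ?_⟩
    obtain ⟨K', hK', rfl⟩ := (hle _ _).1 hxw.le
    -- An intermediate w^{K'} equals w^{K ∩ K'}; minimality of K forces K ∩ K' = K, so nothing lies
    -- strictly between.
    have h := hb.rightRep_inter_eq hK' ((hle _ _).1 hx.le).rightWeakLE
    have h2 := hmin ⟨hb.inter hK', by rw [h]; exact hxw.ne⟩ Set.inter_subset_left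
    rw [Set.inter_eq_left.2 (h2.trans Set.inter_subset_right)] at h
    exact hx.ne h
  · have hb := isRightBlock_of_mem_minimal hK
    have hb' := isRightBlock_of_mem_minimal hK'
    have h' : cs.rightRep K w = cs.rightRep K' w := h
    -- K ∩ K' cuts at the same point, hence is nontrivial, and minimality makes it equal to both
    -- blocks.
    have h1 := hb.rightRep_inter_eq hb' (h' ▸ cs.rightWeakLE_refl _)
    have hn : cs.IsRightBlock w (K ∩ K') ∧ cs.rightRep (K ∩ K') w ≠ w :=
      ⟨hb.inter hb', by rw [h1]; exact rightRep_ne_of_mem_minimal hK'⟩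
    exact Set.Subset.antisymm ((hK.2 hn Set.inter_subset_left).trans Set.inter_subset_right)
      ((hK'.2 hn Set.inter_subset_right).trans Set.inter_subset_left)
  · obtain ⟨K, hK, rfl⟩ := (hle _ _).1 (show u ⋖ w from hu).le
    obtain ⟨K₀, hK₀, hmin⟩ := exists_minimal_le_of_wellFoundedLT
      (fun K => cs.IsRightBlock w K ∧ cs.rightRep K w ≠ w) K
      ⟨hK, (show cs.rightRep K w ⋖ w from hu).ne⟩
    refine ⟨K₀, hmin, ?_⟩
    have h1 : cs.rightRep K w ≤ cs.rightRep K₀ w :=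
      (hle _ _).2 (cutLE_rightRep_of_subset hK hK₀)
    have h2 : cs.rightRep K₀ w ≤ w := (hle _ _).2 hmin.prop.1.cutLE
    exact ((show cs.rightRep K w ⋖ w from hu).eq_or_eq h1 h2).resolve_right hmin.prop.2

/-- The cutting point at the union of a family of minimal blocks. -/
noncomputable def coverMeet (K : {u : W // u ⋖ w} → Set B) (A : Set {u : W // u ⋖ w}) : W :=
  cs.rightRep (⋃ a : A, K a) w

theorem rightWeakLE_coverMeet_iff {K : {u : W // u ⋖ w} → Set B}
    (hK : ∀ u, K u ∈ cs.minimalRightBlocks w) (hKu : ∀ u, cs.rightRep (K u) w = u)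
    (A : Set {u : W // u ⋖ w}) (z : W) : cs.RightWeakLE z (coverMeet (cs := cs) K A) ↔
      cs.RightWeakLE z w ∧ ∀ u ∈ A, cs.RightWeakLE z u := by
  have hb : cs.IsRightBlock w (⋃ a : A, K a) := .iUnion fun a => isRightBlock_of_mem_minimal (hK a)
  constructor
  · intro h
    refine ⟨RightWeakLE.trans cs h hb.rightRep_le, fun u hu => RightWeakLE.trans cs h ?_⟩
    rw [← hKu u]
    exact (isRightBlock_of_mem_minimal (hK u)).rightRep_antitone hb (Set.subset_iUnion (fun a : A => K a) ⟨u, hu⟩)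
  · rintro ⟨h1, h2⟩
    exact IsRightBlock.le_rightRep_iUnion (fun a : A => isRightBlock_of_mem_minimal (hK a)) h1
      fun a => by rw [hKu]; exact h2 a a.2

theorem coverMeet_le {K : {u : W // u ⋖ w} → Set B} (hle : ∀ u w : W, u ≤ w ↔ cs.CutLE u w)
    (hK : ∀ u, K u ∈ cs.minimalRightBlocks w) (A : Set {u : W // u ⋖ w}) :
    coverMeet (cs := cs) K A ≤ w :=
  (hle _ _).2 (IsRightBlock.iUnion fun a : A => isRightBlock_of_mem_minimal (hK a)).cutLE

theorem isFreeMeet_coverMeet {K : {u : W // u ⋖ w} → Set B}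
    (hle : ∀ u w : W, u ≤ w ↔ cs.CutLE u w)
    (hK : ∀ u, K u ∈ cs.minimalRightBlocks w) (hKu : ∀ u, cs.rightRep (K u) w = u) :
    IsFreeMeet (coverMeet (cs := cs) K) where
  isGLB A := by
    have hw := coverMeet_le hle hK A
    have h1 := (rightWeakLE_coverMeet_iff hK hKu A _).1 (cs.rightWeakLE_refl _)
    refine ⟨?_, fun z hz => ?_⟩
    · rintro _ (rfl | ⟨u, hu, rfl⟩)
      · exact hw
      · exact (le_iff_rightWeakLE hle hw u.2.le).2 (h1.2 u hu)
    · have hzw : z ≤ w := hz (by simp)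
      rw [le_iff_rightWeakLE hle hzw hw, rightWeakLE_coverMeet_iff hK hKu]
      exact ⟨((hle _ _).1 hzw).rightWeakLE, fun u hu =>
        ((hle _ _).1 (hz (Or.inr ⟨u, hu, rfl⟩))).rightWeakLE⟩
  mem_of_le A u h := by
    by_contra hu
    have hb : cs.IsRightBlock w (⋃ a : A, K a) := .iUnion fun a => isRightBlock_of_mem_minimal (hK a)
    have h1 : cs.RightWeakLE (cs.rightRep (⋃ a : A, K a) w) (cs.rightRep (K u) w) := by
      rw [hKu]; exact ((hle _ _).1 h).rightWeakLE
    have h2 := hb.rightRep_inter_eq (isRightBlock_of_mem_minimal (hK u)) h1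
    refine rightRep_ne_of_mem_minimal (hK u) ?_
    -- It remains to see that K_u ∩ ⋃ K_a contains no right descent of w. This can be checked on
    -- each K_a ∩ K_u, which is trivial because the two minimal blocks differ.
    rw [← h2, rightRep_eq_self_iff]
    rintro k ⟨hk, hku⟩
    obtain ⟨a, ha⟩ := Set.mem_iUnion.1 hk
    have h3 : cs.rightRep (K a ∩ K u) w = w := by
      by_contra hne
      have hn : cs.IsRightBlock w (K a ∩ K u) ∧ cs.rightRep (K a ∩ K u) w ≠ w :=
        ⟨(isRightBlock_of_mem_minimal (hK a)).inter (isRightBlock_of_mem_minimal (hK u)), hne⟩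
      have h4 : K a = K u := Set.Subset.antisymm
        (((hK a).2 hn Set.inter_subset_left).trans Set.inter_subset_right)
        (((hK u).2 hn Set.inter_subset_right).trans Set.inter_subset_left)
      refine hu (?_ : u ∈ A)
      have h5 : (a : {u : W // u ⋖ w}) = u := Subtype.ext (by rw [← hKu a, ← hKu u, h4])
      exact h5 ▸ a.2
    exact cs.rightRep_eq_self_iff.1 h3 k ⟨ha, hku⟩

theorem rightRep_le_rightRep_iff_and_range [Finite B] [Finite W]
    (hle : ∀ u w : W, u ≤ w ↔ cs.CutLE u w) (w : W) :
    (∀ U U' : unionsOf (cs.minimalRightBlocks w),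
      cs.rightRep (U : Set B) w ≤ cs.rightRep (U' : Set B) w ↔ (U' : Set B) ⊆ U) ∧
    Set.range (fun U : unionsOf (cs.minimalRightBlocks w) => cs.rightRep (U : Set B) w) =
      coverMeets w := by
  have hbij := bijOn_minimalRightBlocks hle w
  have hex : ∀ u : {u : W // u ⋖ w}, ∃ K ∈ cs.minimalRightBlocks w, cs.rightRep K w = u :=
    fun u => hbij.surjOn u.2
  choose K hK hKu using hex
  have hfree := isFreeMeet_coverMeet hle hK hKu
  have hU : ∀ U ∈ unionsOf (cs.minimalRightBlocks w), ∃ A : Set {u : W // u ⋖ w},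
      U = ⋃ a : A, K a := by
    rintro _ ⟨G, hG, rfl⟩
    refine ⟨{a | K a ∈ G}, Set.Subset.antisymm ?_ ?_⟩
    · refine Set.sUnion_subset fun L hL => ?_
      have h1 : K ⟨_, hbij.mapsTo (hG hL)⟩ = L := hbij.injOn (hK _) (hG hL) (hKu _)
      intro k hk
      exact Set.mem_iUnion.2 ⟨⟨⟨_, hbij.mapsTo (hG hL)⟩, by simpa [h1] using hL⟩,
        by simpa [h1] using hk⟩
    · exact Set.iUnion_subset fun a => Set.subset_sUnion_of_mem a.2
  constructor
  · rintro ⟨U, hU1⟩ ⟨U', hU1'⟩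
    obtain ⟨A, rfl⟩ := hU U hU1
    obtain ⟨A', rfl⟩ := hU U' hU1'
    constructor
    · intro h
      have hsub := hfree.le_iff.1 h
      -- Freeness recovers the index sets from the order of the cutting points, so the unions are
      -- nested too.
      exact Set.iUnion_subset fun a => Set.subset_iUnion_of_subset ⟨a, hsub a.2⟩ subset_rfl
    · intro h
      exact (hle _ _).2 (cutLE_rightRep_of_subset (.iUnion fun a => isRightBlock_of_mem_minimal (hK a)) h)
  · rw [← hfree.range_eq]
    ext u
    constructor
    · rintro ⟨⟨U, hU1⟩, rfl⟩
      obtain ⟨A, rfl⟩ := hU U hU1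
      exact ⟨A, rfl⟩
    · rintro ⟨A, rfl⟩
      refine ⟨⟨⋃ a : A, K a, Set.range fun a : A => K a, ?_, by rw [Set.sUnion_range]⟩, rfl⟩
      rintro _ ⟨a, rfl⟩
      exact hK a

/-- Inversion is an automorphism of the cutting order. -/
def invOrderIso (hle : ∀ u w : W, u ≤ w ↔ cs.CutLE u w) : W ≃o W where
  toEquiv := Equiv.inv W
  map_rel_iff' {a b} := by
    simp only [Equiv.inv_apply, hle]
    exact ⟨fun h => by simpa using h.inv, CutLE.inv⟩

/-- Left blocks of w are right blocks of w⁻¹, and inversion preserves the cutting order. -/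
theorem bijOn_minimalLeftBlocks (hle : ∀ u w : W, u ≤ w ↔ cs.CutLE u w) [Finite B] (w : W) :
    Set.BijOn (fun J => cs.leftRep J w) (cs.minimalLeftBlocks w) {u | u ⋖ w} := by
  rw [minimalLeftBlocks_eq]
  simp only [leftRep_eq_inv]
  have h : Set.BijOn (fun u : W => u⁻¹) {u | u ⋖ w⁻¹} {u | u ⋖ w} := by
    refine ⟨fun u hu => ?_, inv_injective.injOn, fun u hu => ⟨u⁻¹, ?_, inv_inv u⟩⟩
    · have := (apply_covBy_apply_iff (invOrderIso hle)).2 (show u ⋖ w⁻¹ from hu)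
      simpa [invOrderIso] using this
    · have := (apply_covBy_apply_iff (invOrderIso hle)).2 (show u ⋖ w from hu)
      simpa [invOrderIso] using this
  exact h.comp (bijOn_minimalRightBlocks hle w⁻¹)

theorem leftRep_le_leftRep_iff_and_range [Finite B] [Finite W]
    (hle : ∀ u w : W, u ≤ w ↔ cs.CutLE u w) (w : W) :
    (∀ U U' : unionsOf (cs.minimalLeftBlocks w),
      cs.leftRep (U : Set B) w ≤ cs.leftRep (U' : Set B) w ↔ (U' : Set B) ⊆ U) ∧
    Set.range (fun U : unionsOf (cs.minimalLeftBlocks w) => cs.leftRep (U : Set B) w) =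
      coverMeets w := by
  rw [minimalLeftBlocks_eq]
  simp only [leftRep_eq_inv]
  obtain ⟨h1, h2⟩ := rightRep_le_rightRep_iff_and_range hle w⁻¹
  constructor
  · intro U U'
    rw [← h1]
    exact (invOrderIso hle).le_iff_le
  · have h3 := image_coverMeets (w := w⁻¹) (invOrderIso hle)
    rw [← h2, ← Set.range_comp] at h3
    have h4 : (invOrderIso hle) w⁻¹ = w := inv_inv w
    rw [h4] at h3
    exact h3

end LowerCovers

end CoxeterSystem

/-! ### The main theorem. -/

theorem mainTheorem3 {B W : Type*} [Group W] {M : CoxeterMatrix B} [Finite B] [Finite W]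
    (cs : CoxeterSystem M W) :
    -- the cutting relation is a partial order `≤` on `W`
    ∃ _ : PartialOrder W, (∀ u w : W, u ≤ w ↔ cs.CutLE u w) ∧
      -- with minimum `1`
      (∀ w : W, 1 ≤ w) ∧
      -- contained in right and in left weak order
      (∀ u w : W, u ≤ w → cs.RightWeakLE u w ∧ cs.LeftWeakLE u w) ∧
      -- every interval is a sublattice of both weak orders
      (∀ u w : W, ∀ x ∈ Set.Icc u w, ∀ y ∈ Set.Icc u w,
        (x ≤ y ↔ cs.RightWeakLE x y) ∧ (x ≤ y ↔ cs.LeftWeakLE x y) ∧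
        (∃ m ∈ Set.Icc u w, IsMeetFor cs.RightWeakLE x y m ∧ IsMeetFor cs.LeftWeakLE x y m) ∧
        (∃ j ∈ Set.Icc u w, IsJoinFor cs.RightWeakLE x y j ∧ IsJoinFor cs.LeftWeakLE x y j)) ∧
      (∀ w : W,
        -- lower covers correspond to minimal nontrivial (right, or left) blocks
        Set.BijOn (fun K => cs.rightRep K w) (cs.minimalRightBlocks w) {u | u ⋖ w} ∧
        Set.BijOn (fun J => cs.leftRep J w) (cs.minimalLeftBlocks w) {u | u ⋖ w} ∧
        -- the meet-semilattice generated by the lower covers is free on them,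
        -- and the Möbius function on it is that of the Boolean lattice
        (∃ φ : (Set {u : W // u ⋖ w})ᵒᵈ ≃o coverMeets w,
          ∀ A : Set {u : W // u ⋖ w},
            IsGLB (insert w (Subtype.val '' A)) (φ (OrderDual.toDual A) : W) ∧
            cs.rightWeakInterval (φ (OrderDual.toDual A) : W) =
              cs.rightWeakInterval w ∩ ⋂ u ∈ A, cs.rightWeakInterval (u : W) ∧
            moebiusFn (φ (OrderDual.toDual A) : W) w = (-1) ^ A.ncard) ∧
        -- it corresponds to the unions of minimal nontrivial (right, or left) blocks
        (∃ ψ : (unionsOf (cs.minimalRightBlocks w))ᵒᵈ ≃o coverMeets w,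
          ∀ U : unionsOf (cs.minimalRightBlocks w),
            (ψ (OrderDual.toDual U) : W) = cs.rightRep (U : Set B) w) ∧
        (∃ ψ : (unionsOf (cs.minimalLeftBlocks w))ᵒᵈ ≃o coverMeets w,
          ∀ U : unionsOf (cs.minimalLeftBlocks w),
            (ψ (OrderDual.toDual U) : W) = cs.leftRep (U : Set B) w) ∧
        -- and to the intersections of the intervals `[1, u]_R`, `u` a lower cover of `w`
        (∃ χ : coverMeets w ≃o
            {X : Set W | ∃ A ⊆ {u : W | u ⋖ w},
              X = cs.rightWeakInterval w ∩ ⋂ u ∈ A, cs.rightWeakInterval u},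
          ∀ u : coverMeets w, (χ u : Set W) = cs.rightWeakInterval (u : W)) ∧
        -- the Möbius function vanishes elsewhere
        (∀ u : W, u ∉ coverMeets w → moebiusFn u w = 0))
  := by
  let _ : PartialOrder W := cs.cuttingOrder
  have hle : ∀ u w : W, u ≤ w ↔ cs.CutLE u w := fun _ _ => Iff.rfl
  refine ⟨inferInstance, hle, cs.one_cutLE, fun u w h => ⟨h.rightWeakLE, h.leftWeakLE⟩,
    fun u w x hx y hy => ⟨
      ⟨CoxeterSystem.CutLE.rightWeakLE, CoxeterSystem.CutLE.of_rightWeakLE hx.2 hy.2⟩,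
      ⟨CoxeterSystem.CutLE.leftWeakLE, CoxeterSystem.CutLE.of_leftWeakLE hx.2 hy.2⟩,
      CoxeterSystem.CutLE.exists_meet_join hx.1 hx.2 hy.1 hy.2⟩, fun w => ?_⟩
  have hbij := CoxeterSystem.bijOn_minimalRightBlocks hle w
  have hex : ∀ u : {u : W // u ⋖ w}, ∃ K ∈ cs.minimalRightBlocks w, cs.rightRep K w = u :=
    fun u => hbij.surjOn u.2
  choose K hK hKu using hex
  have hfree := CoxeterSystem.isFreeMeet_coverMeet hle hK hKu
  have hint : ∀ A, cs.rightWeakInterval (CoxeterSystem.coverMeet (cs := cs) K A) =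
      cs.rightWeakInterval w ∩ ⋂ u ∈ A, cs.rightWeakInterval (u : W) := by
    intro A
    ext z
    simpa [CoxeterSystem.rightWeakInterval] using
      CoxeterSystem.rightWeakLE_coverMeet_iff hK hKu A z
  refine ⟨hbij, CoxeterSystem.bijOn_minimalLeftBlocks hle w, ?_, ?_, ?_, ?_,
    fun u hu => hfree.moebiusFn_eq_zero hu⟩
  · obtain ⟨φ, hφ⟩ := exists_orderIso_of_range_eq (β := (Set {u : W // u ⋖ w})ᵒᵈ)
      (fun A => CoxeterSystem.coverMeet (cs := cs) K (OrderDual.ofDual A))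
      (fun _ _ => hfree.le_iff) hfree.range_eq
    refine ⟨φ, fun A => ?_⟩
    rw [hφ]
    exact ⟨hfree.isGLB A, hint A, hfree.moebiusFn_apply A⟩
  · obtain ⟨h1, h2⟩ := CoxeterSystem.rightRep_le_rightRep_iff_and_range hle w
    obtain ⟨ψ, hψ⟩ := exists_orderIso_of_range_eq (β := (unionsOf (cs.minimalRightBlocks w))ᵒᵈ)
      (fun U => cs.rightRep (OrderDual.ofDual U).1 w) (fun _ _ => h1 _ _) h2
    exact ⟨ψ, fun U => hψ _⟩
  · obtain ⟨h1, h2⟩ := CoxeterSystem.leftRep_le_leftRep_iff_and_range hle w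
    obtain ⟨ψ, hψ⟩ := exists_orderIso_of_range_eq (β := (unionsOf (cs.minimalLeftBlocks w))ᵒᵈ)
      (fun U => cs.leftRep (OrderDual.ofDual U).1 w) (fun _ _ => h1 _ _) h2
    exact ⟨ψ, fun U => hψ _⟩
  · refine exists_orderIso_of_range_eq (fun u : coverMeets w => cs.rightWeakInterval (u : W))
      ?_ ?_
    · have hw : ∀ u : coverMeets w, (u : W) ≤ w := by
        rintro ⟨u, hu⟩
        rw [← hfree.range_eq] at hu
        obtain ⟨A, rfl⟩ := hu
        exact CoxeterSystem.coverMeet_le hle hK A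
      intro u v
      rw [← Subtype.coe_le_coe, CoxeterSystem.le_iff_rightWeakLE hle (hw u) (hw v)]
      -- Inclusion of principal lower sets is comparison in right weak order, which agrees with the
      -- cutting order below w.
      exact ⟨fun h => h (cs.rightWeakLE_refl _),
        fun h z hz => CoxeterSystem.RightWeakLE.trans cs hz h⟩
    · ext X
      constructor
      · rintro ⟨⟨u, hu⟩, rfl⟩
        rw [← hfree.range_eq] at hu
        obtain ⟨A, rfl⟩ := hu
        refine ⟨Subtype.val '' A, ?_, ?_⟩
        · rintro _ ⟨a, -, rfl⟩
          exact a.2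
        · rw [Set.biInter_image]
          exact hint A
      · rintro ⟨A, hA, rfl⟩
        refine ⟨⟨CoxeterSystem.coverMeet (cs := cs) K (Subtype.val ⁻¹' A), ?_⟩, ?_⟩
        · rw [← hfree.range_eq]
          exact ⟨_, rfl⟩
        · refine (hint _).trans ?_
          congr 1
          ext z
          simp only [Set.mem_iInter]
          exact ⟨fun h u hu => h ⟨u, hA hu⟩ hu, fun h u hu => h u hu⟩
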